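/- Let $D$ be an integral domain with quotient field $K$. For a nonzero fractional ideal $I$ of $D$ put $I^{-1}=\{x\in K \mid xI\subseteq D\}$, $I_v=(I^{-1})^{-1}$, and $I_t=\bigcup_H H_v$, where $H$ ranges over the nonzero finitely generated fractional ideals of $D$ contained in $I$; $I$ is called a $v$-ideal if $I=I_v$ and a $t$-ideal if $I=I_t$. The domain $D$ is called a TV domain if every $t$-ideal (among the nonzero fractional ideals) is a $v$-ideal. It is called $t$-sharp if, whenever $I,A,B$ are nonzero ideals of $D$ with $I\supseteq AB$, there exist nonzero ideals $H,J$ of $D$ such that $I_t=(HJ)_t$, $H_t\supseteq A$ and $J_t\supseteq B$. It is called a Krull domain if there is a (possibly empty) set $S$ of discrete rank-one valuation rings with quotient field $K$ such that $D=\bigcap_{V\in S}V$ (the empty intersection being $K$) and every nonzero element of $K$ is a unit in all but finitely many $V\in S$; in particular, fields are Krull domains. Then $D$ is a Krull domain if and only if $D$ is a $t$-sharp TV domain. -/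

import Mathlib

open scoped nonZeroDivisors

namespace StarIdeal

section Closures

variable {D : Type*} [CommRing D] [IsDomain D] {K : Type*} [Field K] [Algebra D K]
  [IsFractionRing D K]

/-- The `v`-closure `I_v = (I⁻¹)⁻¹` of a fractional ideal `I`, where
`I⁻¹ = {x ∈ K | x I ⊆ D}` for `I ≠ 0` (and `0⁻¹ = 0` by convention, so that `0_v = 0`). -/
noncomputable def vClosure (I : FractionalIdeal D⁰ K) : FractionalIdeal D⁰ K :=
  (I⁻¹)⁻¹

theorem vClosure_mono {I J : FractionalIdeal D⁰ K} (h : I ≤ J) : vClosure I ≤ vClosure J := by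
  unfold vClosure
  by_cases hI : I = 0
  · subst hI
    rw [FractionalIdeal.inv_zero', FractionalIdeal.inv_zero']
    exact FractionalIdeal.zero_le _
  · have hJ : J ≠ 0 := fun hJ => hI (le_antisymm (hJ ▸ h) (FractionalIdeal.zero_le _))
    have hne : ∀ L : FractionalIdeal D⁰ K, L ≠ 0 → L⁻¹ ≠ 0 := by
      intro L hL
      obtain ⟨a, aI, ha, rfl⟩ := FractionalIdeal.exists_eq_spanSingleton_mul L
      have ha' : algebraMap D K a ≠ 0 := by
        simpa using ha
      intro h0
      have hmem : algebraMap D K a ∈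
          (FractionalIdeal.spanSingleton D⁰ ((algebraMap D K) a)⁻¹ * (aI : FractionalIdeal D⁰ K))⁻¹ := by
        rw [FractionalIdeal.mem_inv_iff hL]
        intro y hy
        obtain ⟨z, hz, rfl⟩ := FractionalIdeal.mem_singleton_mul.mp hy
        obtain ⟨w, -, rfl⟩ := (FractionalIdeal.mem_coeIdeal _).mp hz
        rw [mul_inv_cancel_left₀ ha']
        exact FractionalIdeal.coe_mem_one _ _
      rw [h0] at hmem
      exact ha' ((FractionalIdeal.mem_zero_iff _).mp hmem)
    exact FractionalIdeal.inv_anti_mono (hne J hJ) (hne I hI)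
      (FractionalIdeal.inv_anti_mono hI hJ h)

/-- The `t`-closure `I_t = ⋃ H_v`, where `H` ranges over the finitely generated fractional ideals
contained in `I`. (The term `H = 0` only contributes the element `0`.) -/
noncomputable def tClosure (I : FractionalIdeal D⁰ K) : FractionalIdeal D⁰ K :=
  ⟨{ carrier := {x | ∃ H : FractionalIdeal D⁰ K,
        H ≤ I ∧ (H : Submodule D K).FG ∧ x ∈ vClosure H}
     zero_mem' := ⟨0, FractionalIdeal.zero_le _,
        by simpa using (Submodule.fg_bot : (⊥ : Submodule D K).FG),
        Submodule.zero_mem (vClosure (0 : FractionalIdeal D⁰ K) : Submodule D K)⟩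
     add_mem' := by
        rintro x y ⟨H, hHI, hH, hx⟩ ⟨L, hLI, hL, hy⟩
        refine ⟨H ⊔ L, sup_le hHI hLI, ?_, ?_⟩
        · rw [FractionalIdeal.coe_sup]
          exact hH.sup hL
        · exact Submodule.add_mem (vClosure (H ⊔ L) : Submodule D K)
            (vClosure_mono (le_sup_left : H ≤ H ⊔ L) hx)
            (vClosure_mono (le_sup_right : L ≤ H ⊔ L) hy)
     smul_mem' := by
        rintro c x ⟨H, hHI, hH, hx⟩
        exact ⟨H, hHI, hH, Submodule.smul_mem (vClosure H : Submodule D K) c hx⟩ },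
    FractionalIdeal.isFractional_of_le (J := vClosure I) (by
      rintro x ⟨H, hHI, -, hx⟩
      exact vClosure_mono hHI hx)⟩

theorem mem_tClosure {I : FractionalIdeal D⁰ K} {x : K} :
    x ∈ tClosure I ↔ ∃ H : FractionalIdeal D⁰ K,
      H ≤ I ∧ (H : Submodule D K).FG ∧ x ∈ vClosure H :=
  Iff.rfl

end Closures

/-- A `t`-sharp domain: whenever `I ⊇ A B` with `I`, `A`, `B` nonzero ideals of `D`, there are
nonzero ideals `H`, `J` of `D` with `I_t = (H J)_t`, `H_t ⊇ A` and `J_t ⊇ B`.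
Here `K` is the quotient field of `D`. -/
def IsTSharp (D : Type*) [CommRing D] [IsDomain D] (K : Type*) [Field K] [Algebra D K]
    [IsFractionRing D K] : Prop :=
  ∀ I A B : Ideal D, I ≠ ⊥ → A ≠ ⊥ → B ≠ ⊥ → A * B ≤ I →
    ∃ H J : Ideal D, H ≠ ⊥ ∧ J ≠ ⊥ ∧
      tClosure (I : FractionalIdeal D⁰ K) = tClosure ((H * J : Ideal D) : FractionalIdeal D⁰ K) ∧
      (A : FractionalIdeal D⁰ K) ≤ tClosure (H : FractionalIdeal D⁰ K) ∧
      (B : FractionalIdeal D⁰ K) ≤ tClosure (J : FractionalIdeal D⁰ K)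

/-- A TV domain: every `t`-ideal (nonzero fractional ideal `I` with `I = I_t`) is a `v`-ideal
(that is, `I = I_v`). -/
def IsTV (D : Type*) [CommRing D] [IsDomain D] (K : Type*) [Field K] [Algebra D K]
    [IsFractionRing D K] : Prop :=
  ∀ I : FractionalIdeal D⁰ K, I ≠ 0 → I = tClosure I → I = vClosure I

/-- A Krull domain: `D` is the intersection of a set `S` of discrete (rank one) valuation rings
of its quotient field `K` such that every nonzero element of `K` is a unit in all but finitely
many members of `S`. The set `S` may be empty, so that fields are Krull domains. -/
def IsKrull (D : Type*) [CommRing D] [IsDomain D] (K : Type*) [Field K] [Algebra D K]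
    [IsFractionRing D K] : Prop :=
  ∃ S : Set (ValuationSubring K),
    (∀ V ∈ S, IsDiscreteValuationRing V) ∧
    (∀ x : K, x ∈ (algebraMap D K).range ↔ ∀ V ∈ S, x ∈ V) ∧
    (∀ x : K, x ≠ 0 → {V ∈ S | V.valuation x ≠ 1}.Finite)

end StarIdeal

namespace StarIdeal

/-! The bridge is the pair of conditions "`t = v` on nonzero fractional ideals" (which is TV, by
`isTV_iff`) and "every nonzero ideal is `v`-invertible" (`AllVInvertible`). Given `t = v`,
`t`-sharpness and `v`-invertibility imply each other: one way by factoring a principal ideal, the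
other by taking H = I + A, J = I H⁻¹. Together the two conditions make every ideal `v`-finite, so
divisorial ideals satisfy ACC. The maximal proper divisorial ideals P are then prime,
`v`-invertibility makes each D_P a DVR, and ACC gives finite character; D is the intersection of the
D_P, hence Krull. Conversely, a Krull domain is completely integrally closed, which gives
`v`-invertibility, and finite character yields `StronglyVFinite`, which forces `t = v`. -/

theorem ne_zero_of_ne_zero_le {D : Type*} [CommRing D] {K : Type*} [Field K] [Algebra D K]
    {I J : FractionalIdeal D⁰ K} (hI : I ≠ 0) (h : I ≤ J) : J ≠ 0 := by
  rintro rfl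
  exact hI (le_antisymm h (FractionalIdeal.zero_le _))

/-! ### Arithmetic of the `v`- and `t`-closures -/

section VClosure

variable {D : Type*} [CommRing D] [IsDomain D] {K : Type*} [Field K] [Algebra D K]
  [IsFractionRing D K] {I J : FractionalIdeal D⁰ K}

theorem le_inv_iff_mul_le_one (hJ : J ≠ 0) : I ≤ J⁻¹ ↔ I * J ≤ 1 := by
  rw [FractionalIdeal.inv_eq, FractionalIdeal.le_div_iff_mul_le hJ]

theorem mul_inv_le_one (I : FractionalIdeal D⁰ K) : I * I⁻¹ ≤ 1 := by
  by_cases hI : I = 0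
  · simp [hI]
  · rw [mul_comm, ← le_inv_iff_mul_le_one hI]

theorem inv_ne_zero_of_ne_zero (hI : I ≠ 0) : I⁻¹ ≠ 0 := by
  intro h
  have := FractionalIdeal.bot_lt_mul_inv (I := I) hI
  rw [h, mul_zero] at this
  exact lt_irrefl _ this

theorem mul_ne_zero_of_ne_zero (hI : I ≠ 0) (hJ : J ≠ 0) : I * J ≠ 0 := by
  obtain ⟨x, hx, hx0⟩ := FractionalIdeal.exists_ne_zero_mem_isInteger hI
  obtain ⟨y, hy, hy0⟩ := FractionalIdeal.exists_ne_zero_mem_isInteger hJ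
  intro h
  have := FractionalIdeal.mul_mem_mul hx0 hy0
  rw [h, FractionalIdeal.mem_zero_iff, ← map_mul] at this
  exact mul_ne_zero hx hy (by simpa using this)

theorem le_vClosure (I : FractionalIdeal D⁰ K) : I ≤ vClosure I := by
  by_cases hI : I = 0
  · rw [hI]; exact FractionalIdeal.zero_le _
  · exact (le_inv_iff_mul_le_one (inv_ne_zero_of_ne_zero hI)).2 (mul_inv_le_one I)

theorem vClosure_ne_zero (hI : I ≠ 0) : vClosure I ≠ 0 :=
  ne_zero_of_ne_zero_le hI (le_vClosure I)

theorem inv_vClosure (hI : I ≠ 0) : (vClosure I)⁻¹ = I⁻¹ :=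
  le_antisymm (FractionalIdeal.inv_anti_mono hI (vClosure_ne_zero hI) (le_vClosure I))
    (le_vClosure I⁻¹)

theorem vClosure_vClosure (I : FractionalIdeal D⁰ K) : vClosure (vClosure I) = vClosure I := by
  by_cases hI : I = 0
  · simp [hI, vClosure, FractionalIdeal.inv_zero']
  · rw [vClosure, inv_vClosure hI, vClosure]

theorem vClosure_inv (hI : I ≠ 0) : vClosure I⁻¹ = I⁻¹ := inv_vClosure hI

theorem vClosure_one : vClosure (1 : FractionalIdeal D⁰ K) = 1 := by
  simp [vClosure]

theorem vClosure_le_of_le (h : I ≤ vClosure J) : vClosure I ≤ vClosure J :=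
  vClosure_vClosure J ▸ vClosure_mono h

theorem vClosure_le_one (h : I ≤ 1) : vClosure I ≤ 1 :=
  vClosure_one (D := D) (K := K) ▸ vClosure_mono h

theorem mul_vClosure_le (I J : FractionalIdeal D⁰ K) : I * vClosure J ≤ vClosure (I * J) := by
  by_cases hI : I = 0
  · simp [hI]
  by_cases hJ : J = 0
  · simp [hJ, vClosure, FractionalIdeal.inv_zero']
  have hIJ := mul_ne_zero_of_ne_zero hI hJ
  have h1 : I * (I * J)⁻¹ ≤ J⁻¹ := by
    rw [le_inv_iff_mul_le_one hJ, mul_right_comm]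
    exact mul_inv_le_one _
  rw [vClosure.eq_1 (I * J), le_inv_iff_mul_le_one (inv_ne_zero_of_ne_zero hIJ), mul_right_comm]
  calc _ ≤ J⁻¹ * vClosure J := mul_le_mul_left h1 _
    _ ≤ 1 := mul_inv_le_one _

theorem vClosure_mul_le (I J : FractionalIdeal D⁰ K) : vClosure I * J ≤ vClosure (I * J) := by
  rw [mul_comm, mul_comm I]
  exact mul_vClosure_le J I

theorem vClosure_spanSingleton (x : K) :
    vClosure (FractionalIdeal.spanSingleton D⁰ x) = FractionalIdeal.spanSingleton D⁰ x := by
  simp [vClosure]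

theorem tClosure_le_vClosure (I : FractionalIdeal D⁰ K) : tClosure I ≤ vClosure I := by
  rintro x ⟨H, hHI, -, hx⟩
  exact vClosure_mono hHI hx

theorem le_tClosure (I : FractionalIdeal D⁰ K) : I ≤ tClosure I := by
  intro x hx
  refine ⟨FractionalIdeal.spanSingleton D⁰ x, FractionalIdeal.spanSingleton_le_iff_mem.2 hx, ?_,
    le_vClosure _ (FractionalIdeal.mem_spanSingleton_self _ x)⟩
  rw [FractionalIdeal.coe_spanSingleton]
  exact Submodule.fg_span_singleton x

/-- Each generator has its own finitely generated witness, and the sum of finitely many witnesses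
serves for all. This makes `tClosure` idempotent. -/
theorem exists_fg_le_vClosure_of_le_tClosure {N : Submodule D K} (hN : N.FG)
    (h : N ≤ (tClosure I : Submodule D K)) :
    ∃ G ≤ I, (G : Submodule D K).FG ∧ N ≤ (vClosure G : Submodule D K) := by
  induction N, hN using Submodule.fg_induction with
  | singleton x =>
    obtain ⟨H, h1, h2, h3⟩ := mem_tClosure.1 (h (Submodule.mem_span_singleton_self x))
    exact ⟨H, h1, h2, (Submodule.span_singleton_le_iff_mem _ _).2 h3⟩
  | sup M N _ _ hM hN =>
    obtain ⟨G, h1, h2, h3⟩ := hM (le_sup_left.trans h)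
    obtain ⟨H, k1, k2, k3⟩ := hN (le_sup_right.trans h)
    refine ⟨G ⊔ H, sup_le h1 k1, ?_, sup_le ?_ ?_⟩
    · rw [FractionalIdeal.coe_sup]
      exact h2.sup k2
    · exact h3.trans (vClosure_mono (le_sup_left : G ≤ G ⊔ H))
    · exact k3.trans (vClosure_mono (le_sup_right : H ≤ G ⊔ H))

theorem tClosure_tClosure (I : FractionalIdeal D⁰ K) : tClosure (tClosure I) = tClosure I := by
  refine le_antisymm ?_ (le_tClosure _)
  rintro x ⟨H, hHI, hH, hx⟩
  obtain ⟨G, h1, h2, h3⟩ := exists_fg_le_vClosure_of_le_tClosure hH hHI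
  exact ⟨G, h1, h2, vClosure_le_of_le h3 hx⟩

theorem isTV_iff : IsTV D K ↔ ∀ I : FractionalIdeal D⁰ K, I ≠ 0 → tClosure I = vClosure I := by
  constructor
  · intro h I hI
    refine le_antisymm (tClosure_le_vClosure I) ?_
    rw [h (tClosure I) (ne_zero_of_ne_zero_le hI (le_tClosure I)) (tClosure_tClosure I).symm]
    exact vClosure_mono (le_tClosure I)
  · intro h I hI ht
    rw [← h I hI, ← ht]

theorem exists_ideal_coe_eq_vClosure (A : Ideal D) :
    ∃ B : Ideal D, (B : FractionalIdeal D⁰ K) = vClosure (A : FractionalIdeal D⁰ K) :=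
  FractionalIdeal.le_one_iff_exists_coeIdeal.1 (vClosure_le_one FractionalIdeal.coeIdeal_le_one)

/-! ### `t`-sharpness versus `v`-invertibility -/

variable (D K) in
/-- Every nonzero ideal of `D` is `v`-invertible (equivalently, `D` is completely integrally
closed). -/
def AllVInvertible : Prop :=
  ∀ A : Ideal D, A ≠ ⊥ →
    vClosure ((A : FractionalIdeal D⁰ K) * (A : FractionalIdeal D⁰ K)⁻¹) = 1

/-- For 0 ≠ x ∈ A, sharpness is applied to (x) ⊇ A · xA⁻¹. The factors of (x) = (HJ)_v dominate A
and xA⁻¹ up to `v`, and having product (x) they cannot be larger: H ⊆ A_v and x⁻¹J ⊆ A⁻¹. Dividing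
by x then gives 1 ∈ (A A⁻¹)_v. -/
theorem AllVInvertible.of_isTSharp (hs : IsTSharp D K)
    (ht : ∀ I : FractionalIdeal D⁰ K, I ≠ 0 → tClosure I = vClosure I) : AllVInvertible D K := by
  intro A hA
  obtain ⟨x, hxA, hx⟩ := Submodule.exists_mem_ne_zero_of_ne_bot hA
  set X : FractionalIdeal D⁰ K := FractionalIdeal.spanSingleton D⁰ (algebraMap D K x) with hX
  have hx' : algebraMap D K x ≠ 0 := by simpa using hx
  have hX0 : X ≠ 0 := FractionalIdeal.spanSingleton_ne_zero_iff.2 hx'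
  have hA' : (A : FractionalIdeal D⁰ K) ≠ 0 := FractionalIdeal.coeIdeal_ne_zero.2 hA
  have hAi := inv_ne_zero_of_ne_zero hA'
  have hXA : X ≤ A := FractionalIdeal.spanSingleton_le_iff_mem.2
    (FractionalIdeal.mem_coeIdeal_of_mem _ hxA)
  -- B = xA⁻¹, which is integral because x ∈ A.
  obtain ⟨B, hB⟩ := FractionalIdeal.le_one_iff_exists_coeIdeal.1
    ((mul_le_mul_left hXA (A : FractionalIdeal D⁰ K)⁻¹).trans (mul_inv_le_one _))
  have hB0 : B ≠ ⊥ := by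
    rw [← FractionalIdeal.coeIdeal_ne_zero (K := K), hB]
    exact mul_ne_zero_of_ne_zero hX0 hAi
  have hxs : ((Ideal.span {x} : Ideal D) : FractionalIdeal D⁰ K) = X :=
    FractionalIdeal.coeIdeal_span_singleton x
  obtain ⟨H, J, hH, hJ, h1, h2, h3⟩ := hs (Ideal.span {x}) A B (by simpa using hx) hA hB0 (by
    rw [← FractionalIdeal.coeIdeal_le_coeIdeal K, FractionalIdeal.coeIdeal_mul, hB, hxs,
      mul_left_comm]
    exact (mul_le_mul_right (mul_inv_le_one _) X).trans (mul_one X).le)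
  have hH' : (H : FractionalIdeal D⁰ K) ≠ 0 := FractionalIdeal.coeIdeal_ne_zero.2 hH
  have hJ' : (J : FractionalIdeal D⁰ K) ≠ 0 := FractionalIdeal.coeIdeal_ne_zero.2 hJ
  rw [hxs, FractionalIdeal.coeIdeal_mul, ht _ hX0, ht _ (mul_ne_zero_of_ne_zero hH' hJ'), hX,
    vClosure_spanSingleton, ← hX] at h1
  rw [ht _ hH'] at h2
  rw [ht _ hJ', hB] at h3
  generalize (H : FractionalIdeal D⁰ K) = H', (J : FractionalIdeal D⁰ K) = J' at h1 h2 h3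
  have cancel : ∀ {M N : FractionalIdeal D⁰ K}, X * M ≤ X * N → M ≤ N := by
    intro M N h
    have h' := mul_le_mul_right h X⁻¹
    rwa [← mul_assoc, ← mul_assoc, FractionalIdeal.spanSingleton_inv_mul K hx', one_mul,
      one_mul] at h'
  have hHA : H' ≤ vClosure A := by
    rw [vClosure, le_inv_iff_mul_le_one hAi]
    apply cancel
    calc X * (H' * (A : FractionalIdeal D⁰ K)⁻¹) = H' * (X * (A : FractionalIdeal D⁰ K)⁻¹) :=
          mul_left_comm _ _ _
      _ ≤ H' * vClosure J' := mul_le_mul_right h3 _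
      _ ≤ vClosure (H' * J') := mul_vClosure_le _ _
      _ = X * 1 := by rw [← h1, mul_one]
  have hJA : X⁻¹ * J' ≤ (A : FractionalIdeal D⁰ K)⁻¹ := by
    rw [le_inv_iff_mul_le_one hA']
    apply cancel
    calc X * (X⁻¹ * J' * A) = A * J' := by
          rw [← mul_assoc, ← mul_assoc, FractionalIdeal.spanSingleton_mul_inv K hx', one_mul,
            mul_comm]
      _ ≤ vClosure H' * J' := mul_le_mul_left h2 _
      _ ≤ vClosure (H' * J') := vClosure_mul_le _ _
      _ = X * 1 := by rw [← h1, mul_one]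
  refine le_antisymm (vClosure_le_one (mul_inv_le_one _)) ?_
  calc (1 : FractionalIdeal D⁰ K) = X⁻¹ * X := (FractionalIdeal.spanSingleton_inv_mul K hx').symm
    _ = X⁻¹ * vClosure (H' * J') := by rw [← h1]
    _ ≤ vClosure (X⁻¹ * (H' * J')) := mul_vClosure_le _ _
    _ = vClosure (H' * (X⁻¹ * J')) := by rw [mul_left_comm]
    _ ≤ vClosure (vClosure A * (A : FractionalIdeal D⁰ K)⁻¹) := vClosure_mono (mul_le_mul' hHA hJA)
    _ ≤ _ := vClosure_le_of_le (vClosure_mul_le _ _)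

theorem AllVInvertible.le_vClosure_mul (hv : AllVInvertible D K) {A : Ideal D} (hA : A ≠ ⊥)
    (M : FractionalIdeal D⁰ K) :
    M ≤ vClosure (M * ((A : FractionalIdeal D⁰ K) * (A : FractionalIdeal D⁰ K)⁻¹)) := by
  simpa [hv A hA] using
    mul_vClosure_le M ((A : FractionalIdeal D⁰ K) * (A : FractionalIdeal D⁰ K)⁻¹)

/-- With H = I + A and J = I H⁻¹, `v`-invertibility of H gives (HJ)_v = I_v. Since BH ⊆ I, also B ⊆
(B H H⁻¹)_v ⊆ J_v. -/
theorem AllVInvertible.isTSharp (hv : AllVInvertible D K)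
    (ht : ∀ I : FractionalIdeal D⁰ K, I ≠ 0 → tClosure I = vClosure I) : IsTSharp D K := by
  intro I A B hI hA hB hAB
  have hH : I ⊔ A ≠ ⊥ := fun h => hI (le_bot_iff.1 (h ▸ le_sup_left))
  have hI' : (I : FractionalIdeal D⁰ K) ≠ 0 := FractionalIdeal.coeIdeal_ne_zero.2 hI
  have hH' : ((I ⊔ A : Ideal D) : FractionalIdeal D⁰ K) ≠ 0 := FractionalIdeal.coeIdeal_ne_zero.2 hH
  have hle : (I : FractionalIdeal D⁰ K) ≤ (I ⊔ A : Ideal D) :=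
    (FractionalIdeal.coeIdeal_le_coeIdeal K).2 le_sup_left
  obtain ⟨J, hJ⟩ := FractionalIdeal.le_one_iff_exists_coeIdeal.1
    ((mul_le_mul_left hle ((I ⊔ A : Ideal D) : FractionalIdeal D⁰ K)⁻¹).trans (mul_inv_le_one _))
  have hJ0' : (J : FractionalIdeal D⁰ K) ≠ 0 := by
    rw [hJ]
    exact mul_ne_zero_of_ne_zero hI' (inv_ne_zero_of_ne_zero hH')
  refine ⟨I ⊔ A, J, hH, FractionalIdeal.coeIdeal_ne_zero.1 hJ0', ?_, ?_, ?_⟩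
  · rw [FractionalIdeal.coeIdeal_mul, ht _ hI', ht _ (mul_ne_zero_of_ne_zero hH' hJ0'), hJ,
      ← mul_assoc, mul_comm _ (I : FractionalIdeal D⁰ K), mul_assoc]
    apply le_antisymm
    · exact vClosure_le_of_le (hv.le_vClosure_mul hH _)
    · exact vClosure_mono ((mul_le_mul_right (mul_inv_le_one _) _).trans (mul_one _).le)
  · exact ((FractionalIdeal.coeIdeal_le_coeIdeal K).2 le_sup_right).trans (le_tClosure _)
  · rw [ht _ hJ0', hJ]
    have hBH : (B * (I ⊔ A : Ideal D) : Ideal D) ≤ I := by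
      rw [Ideal.mul_sup]
      exact sup_le Ideal.mul_le_right (mul_comm A B ▸ hAB)
    rw [← FractionalIdeal.coeIdeal_le_coeIdeal K, FractionalIdeal.coeIdeal_mul] at hBH
    refine (hv.le_vClosure_mul hH _).trans (vClosure_mono ?_)
    rw [← mul_assoc]
    exact mul_le_mul_left hBH _

variable (D K) in
/-- Every nonzero fractional ideal has the same `v`-closure as a finitely generated fractional
ideal contained in it. -/
def StronglyVFinite : Prop :=
  ∀ I : FractionalIdeal D⁰ K, I ≠ 0 →
    ∃ G ≤ I, (G : Submodule D K).FG ∧ I ≤ vClosure G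

theorem StronglyVFinite.tClosure_eq (h : StronglyVFinite D K) (hI : I ≠ 0) :
    tClosure I = vClosure I := by
  refine le_antisymm (tClosure_le_vClosure I) fun x hx => ?_
  obtain ⟨G, h1, h2, h3⟩ := h I hI
  exact ⟨G, h1, h2, vClosure_le_of_le h3 hx⟩

end VClosure

theorem exists_fg_le_mul {R A : Type*} [CommSemiring R] [Semiring A] [Algebra R A]
    {P Q N : Submodule R A} (hN : N.FG) (h : N ≤ P * Q) : ∃ P' ≤ P, P'.FG ∧ N ≤ P' * Q := by
  induction N, hN using Submodule.fg_induction with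
  | singleton x =>
    obtain ⟨T, T', hT, hT', hx⟩ :=
      Submodule.mem_span_mul_finite_of_mem_mul (h (Submodule.mem_span_singleton_self x))
    refine ⟨Submodule.span R T, Submodule.span_le.2 hT, ⟨T, rfl⟩, ?_⟩
    rw [Submodule.span_singleton_le_iff_mem]
    rw [← Submodule.span_mul_span] at hx
    exact mul_le_mul' le_rfl (Submodule.span_le.2 hT') hx
  | sup M N _ _ hM hN =>
    obtain ⟨G, h1, h2, h3⟩ := hM (le_sup_left.trans h)
    obtain ⟨H, k1, k2, k3⟩ := hN (le_sup_right.trans h)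
    exact ⟨G ⊔ H, sup_le h1 k1, h2.sup k2, sup_le
      (h3.trans (mul_le_mul' le_sup_left le_rfl))
      (k3.trans (mul_le_mul' le_sup_right le_rfl))⟩

/-! ### Divisorial ideals and their localizations -/

section Divisorial

variable {D : Type*} [CommRing D] [IsDomain D] {K : Type*} [Field K] [Algebra D K]
  [IsFractionRing D K]

/-- As 1 ∈ (A A⁻¹)_t, already 1 ∈ (G A⁻¹)_v for some finitely generated G ⊆ A; multiplying by A
gives A ⊆ (G A A⁻¹)_v ⊆ G_v. -/
theorem AllVInvertible.exists_fg (hv : AllVInvertible D K)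
    (ht : ∀ I : FractionalIdeal D⁰ K, I ≠ 0 → tClosure I = vClosure I) {A : Ideal D} (hA : A ≠ ⊥) :
    ∃ G ≤ A, G.FG ∧ (A : FractionalIdeal D⁰ K) ≤ vClosure (G : FractionalIdeal D⁰ K) := by
  have hA' : (A : FractionalIdeal D⁰ K) ≠ 0 := FractionalIdeal.coeIdeal_ne_zero.2 hA
  have h1 : (1 : K) ∈ tClosure ((A : FractionalIdeal D⁰ K) * (A : FractionalIdeal D⁰ K)⁻¹) := by
    rw [ht _ (mul_ne_zero_of_ne_zero hA' (inv_ne_zero_of_ne_zero hA')), hv A hA]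
    exact FractionalIdeal.one_mem_one _
  obtain ⟨H, hH, hHfg, h1⟩ := mem_tClosure.1 h1
  obtain ⟨G, hGA, hGfg, hHG⟩ := exists_fg_le_mul (P := ((A : FractionalIdeal D⁰ K) : Submodule D K))
    (Q := ((A : FractionalIdeal D⁰ K)⁻¹ : FractionalIdeal D⁰ K)) hHfg
    (by rw [← FractionalIdeal.coe_mul]; exact hH)
  set G' : FractionalIdeal D⁰ K := ⟨G, FractionalIdeal.isFractional_of_fg hGfg⟩ with hG'
  have hGA' : G' ≤ A := hGA
  obtain ⟨B, hB⟩ := FractionalIdeal.le_one_iff_exists_coeIdeal.1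
    (hGA'.trans FractionalIdeal.coeIdeal_le_one)
  refine ⟨B, ?_, ?_, ?_⟩
  · rwa [← FractionalIdeal.coeIdeal_le_coeIdeal K, hB]
  · rw [← FractionalIdeal.coeIdeal_fg D⁰ (IsFractionRing.injective D K), hB]
    exact hGfg
  · rw [hB]
    have hHG' : H ≤ G' * (A : FractionalIdeal D⁰ K)⁻¹ := by
      rw [← FractionalIdeal.coe_le_coe, FractionalIdeal.coe_mul]
      exact hHG
    have hone : 1 ≤ vClosure H := by
      rwa [← FractionalIdeal.spanSingleton_one, FractionalIdeal.spanSingleton_le_iff_mem]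
    have hmul := mul_vClosure_le (A : FractionalIdeal D⁰ K) (G' * (A : FractionalIdeal D⁰ K)⁻¹)
    rw [mul_left_comm] at hmul
    calc (A : FractionalIdeal D⁰ K) = (A : FractionalIdeal D⁰ K) * 1 := (mul_one _).symm
      _ ≤ (A : FractionalIdeal D⁰ K) * vClosure (G' * (A : FractionalIdeal D⁰ K)⁻¹) :=
        mul_le_mul_right (hone.trans (vClosure_mono hHG')) _
      _ ≤ _ := hmul
      _ ≤ vClosure G' := vClosure_mono
        ((mul_le_mul_right (mul_inv_le_one _) _).trans (mul_one _).le)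

variable (K) in
/-- A nonzero integral ideal equal to its `v`-closure. -/
def IsDivisorial (A : Ideal D) : Prop :=
  A ≠ ⊥ ∧ vClosure (A : FractionalIdeal D⁰ K) = A

theorem IsDivisorial.of_vClosure_le {A : Ideal D} (hA : A ≠ ⊥)
    (h : ∀ B : Ideal D, (B : FractionalIdeal D⁰ K) = vClosure (A : FractionalIdeal D⁰ K) → B ≤ A) :
    IsDivisorial K A := by
  obtain ⟨B, hB⟩ := exists_ideal_coe_eq_vClosure (K := K) A
  refine ⟨hA, le_antisymm ?_ (le_vClosure _)⟩
  rw [← hB, FractionalIdeal.coeIdeal_le_coeIdeal]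
  exact h B hB

/-- The union of a chain lies in G_v for a finitely generated G inside it. Some member contains G,
hence, being divisorial, the whole union. -/
theorem AllVInvertible.wellFoundedGT (hv : AllVInvertible D K)
    (ht : ∀ I : FractionalIdeal D⁰ K, I ≠ 0 → tClosure I = vClosure I) :
    WellFoundedGT {A : Ideal D // IsDivisorial K A} := by
  rw [wellFoundedGT_iff_monotone_chain_condition]
  intro f
  set A : Ideal D := ⨆ n, (f n : Ideal D) with hA
  have hmono : Monotone fun n => (f n : Ideal D) := fun m n h => f.monotone h
  have hA0 : A ≠ ⊥ := fun h => (f 0).2.1 (le_bot_iff.1 (h ▸ le_iSup (fun n => (f n : Ideal D)) 0))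
  obtain ⟨G, hGA, hG, hAG⟩ := hv.exists_fg ht hA0
  replace hG := (Submodule.fg_iff_compact G).1 hG
  rw [CompleteLattice.isCompactElement_iff_le_of_directed_sSup_le] at hG
  obtain ⟨_, ⟨n, rfl⟩, hn⟩ := hG (Set.range fun n => (f n : Ideal D)) (Set.range_nonempty _)
    (hmono.directed_le.directedOn_range) hGA
  refine ⟨n, fun m hm => le_antisymm (f.monotone hm) ?_⟩
  have : (f m : Ideal D) ≤ (f n : Ideal D) := by
    rw [← FractionalIdeal.coeIdeal_le_coeIdeal K, ← (f n).2.2]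
    calc ((f m : Ideal D) : FractionalIdeal D⁰ K) ≤ A :=
        (FractionalIdeal.coeIdeal_le_coeIdeal K).2 (le_iSup (fun n => (f n : Ideal D)) m)
      _ ≤ _ := hAG
      _ ≤ _ := vClosure_mono ((FractionalIdeal.coeIdeal_le_coeIdeal K).2 hn)
  exact this

/-- The predicate `p` is left general: it is used for proper divisorial ideals and again for the
family in `finite_maximalDivisorial_mem`. -/
theorem exists_maximal_divisorial [WellFoundedGT {A : Ideal D // IsDivisorial K A}]
    {p : Ideal D → Prop} (hp : ∀ A, p A → IsDivisorial K A) {A : Ideal D} (hA : p A) :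
    ∃ P, A ≤ P ∧ Maximal p P := by
  obtain ⟨⟨P, hP⟩, ⟨hpP, hAP⟩, hmax⟩ :=
    (wellFounded_gt (α := {A : Ideal D // IsDivisorial K A})).has_min {B | p B ∧ A ≤ B} ⟨⟨A, hp A hA⟩, hA, le_rfl⟩
  refine ⟨P, hAP, hpP, fun B hB h => ?_⟩
  by_contra hBP
  exact hmax ⟨B, hp B hB⟩ ⟨hB, hAP.trans h⟩ (lt_of_le_not_ge h hBP)

variable (K) in
/-- `P` is maximal among the proper divisorial ideals. -/
def IsMaximalDivisorial (P : Ideal D) : Prop :=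
  Maximal (fun A => IsDivisorial K A ∧ A ≠ ⊤) P

/-- If x ∉ P, maximality forces (P + (x))_v = D; since y(P + (x)) ⊆ P, taking `v`-closures puts y in
P_v = P. -/
theorem IsMaximalDivisorial.isPrime {P : Ideal D} (hP : IsMaximalDivisorial K P) : P.IsPrime := by
  refine ⟨hP.1.2, fun {x y} hxy => or_iff_not_imp_left.2 fun hx => ?_⟩
  have hle : P ≤ P ⊔ Ideal.span {x} := le_sup_left
  obtain ⟨B, hB⟩ := exists_ideal_coe_eq_vClosure (K := K) (P ⊔ Ideal.span {x})
  have hQB : P ⊔ Ideal.span {x} ≤ B := by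
    rw [← FractionalIdeal.coeIdeal_le_coeIdeal K, hB]
    exact le_vClosure _
  have hBtop : B = ⊤ := by
    by_contra hne
    have hBP : B ≤ P := hP.2 ⟨⟨fun h => hP.1.1.1 (le_bot_iff.1 (h ▸ hle.trans hQB)), by
      rw [hB, vClosure_vClosure]⟩, hne⟩ (hle.trans hQB)
    exact hx (hBP (hQB (Ideal.mem_sup_right (Ideal.mem_span_singleton_self x))))
  have hyQ : Ideal.span {y} * (P ⊔ Ideal.span {x}) ≤ P := by
    rw [Ideal.mul_sup, Ideal.span_singleton_mul_span_singleton]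
    exact sup_le Ideal.mul_le_right
      ((Ideal.span_singleton_le_iff_mem _).2 (mul_comm x y ▸ hxy))
  have : Ideal.span {y} * B ≤ P := by
    rw [← FractionalIdeal.coeIdeal_le_coeIdeal K, FractionalIdeal.coeIdeal_mul, hB, ← hP.1.1.2]
    refine (mul_vClosure_le _ _).trans (vClosure_mono ?_)
    rwa [← FractionalIdeal.coeIdeal_mul, FractionalIdeal.coeIdeal_le_coeIdeal]
  rw [hBtop, Ideal.mul_top, Ideal.span_singleton_le_iff_mem] at this
  exact this

/-- This says that q generates A D_P. The ideal A A⁻¹ is not inside P, since its `v`-closure is D;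
so s = jq ∉ P for some q ∈ A, j ∈ A⁻¹, and sa = q(ja) with ja ∈ D. -/
theorem AllVInvertible.exists_local_generator (hv : AllVInvertible D K) {P : Ideal D}
    (hP : IsMaximalDivisorial K P) {A : Ideal D} (hA : A ≠ ⊥) :
    ∃ q ∈ A, ∃ s ∉ P, ∀ a ∈ A, ∃ d, s * a = q * d := by
  have hA' : (A : FractionalIdeal D⁰ K) ≠ 0 := FractionalIdeal.coeIdeal_ne_zero.2 hA
  by_contra! hcon
  have hle : (A : FractionalIdeal D⁰ K) * (A : FractionalIdeal D⁰ K)⁻¹ ≤ P := by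
    rw [FractionalIdeal.mul_le]
    intro i hi j hj
    obtain ⟨q, hq, rfl⟩ := (FractionalIdeal.mem_coeIdeal _).1 hi
    rw [FractionalIdeal.mem_inv_iff hA'] at hj
    have key : ∀ a ∈ A, ∃ d, algebraMap D K d = j * algebraMap D K a := fun a ha =>
      (FractionalIdeal.mem_one_iff _).1 (hj _ (FractionalIdeal.mem_coeIdeal_of_mem _ ha))
    obtain ⟨s, hs⟩ := key q hq
    rw [mul_comm, ← hs]
    refine FractionalIdeal.mem_coeIdeal_of_mem _ ?_
    by_contra hsP
    obtain ⟨a, ha, hd⟩ := hcon q hq s hsP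
    obtain ⟨d, hd'⟩ := key a ha
    refine hd d (IsFractionRing.injective D K ?_)
    rw [map_mul, map_mul, hs, hd']
    ring
  have h1 := vClosure_mono hle
  rw [hv A hA, hP.1.1.2, ← FractionalIdeal.coeIdeal_top,
    FractionalIdeal.coeIdeal_le_coeIdeal] at h1
  exact hP.1.2 (top_le_iff.1 h1)

/-- V is D_P realised inside K. Its ideals are extended from D, so local generators make it a PID;
it is local, and not a field as P ≠ 0. -/
theorem exists_valuationSubring_of_local_generator {P : Ideal D} [P.IsPrime] (hP0 : P ≠ ⊥)
    (h : ∀ A : Ideal D, A ≠ ⊥ → ∃ q ∈ A, ∃ s ∉ P, ∀ a ∈ A, ∃ d, s * a = q * d) :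
    ∃ V : ValuationSubring K, IsDiscreteValuationRing V ∧
      ∀ x, x ∈ V ↔ ∃ a, ∃ s ∉ P, x = algebraMap D K a * (algebraMap D K s)⁻¹ := by
  have hS : P.primeCompl ≤ D⁰ := P.primeCompl_le_nonZeroDivisors
  let R : Subalgebra D K := Localization.subalgebra.ofField K P.primeCompl hS
  have : IsLocalization.AtPrime R P :=
    Localization.subalgebra.isLocalization_ofField K P.primeCompl hS
  have hloc : IsLocalRing R := IsLocalization.AtPrime.isLocalRing R P
  have hfrac : IsFractionRing R K :=
    IsFractionRing.isFractionRing_of_isLocalization P.primeCompl R K hS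
  have hpid : IsPrincipalIdealRing R := by
    refine ⟨fun I => ?_⟩
    have hmap := IsLocalization.map_under P.primeCompl R I
    by_cases hA : Ideal.under D I = ⊥
    · rw [hA, Ideal.map_bot] at hmap
      rw [← hmap]
      infer_instance
    · obtain ⟨q, hq, s, hs, hd⟩ := h _ hA
      refine ⟨algebraMap D R q, le_antisymm ?_ ?_⟩
      · rw [← hmap, Ideal.map_le_iff_le_comap]
        intro a ha
        obtain ⟨d, hd⟩ := hd a ha
        obtain ⟨u, hu⟩ := IsLocalization.map_units R (⟨s, hs⟩ : P.primeCompl)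
        change algebraMap D R a ∈ Ideal.span {algebraMap D R q}
        rw [Ideal.mem_span_singleton, ← u.dvd_mul_left, hu]
        change _ ∣ algebraMap D R s * _
        rw [← map_mul, hd, map_mul]
        exact dvd_mul_right _ _
      · exact (Ideal.span_singleton_le_iff_mem _).2 hq
  have hdvr : IsDiscreteValuationRing R :=
    { hpid, hloc with
      not_a_field' := by
        intro h0
        obtain ⟨p, hp, hp0⟩ := Submodule.exists_mem_ne_zero_of_ne_bot hP0
        have := (IsLocalization.AtPrime.to_map_mem_maximal_iff R P p hloc).2 hp
        rw [h0, Ideal.mem_bot] at this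
        exact hp0 ((map_eq_zero_iff _ (IsLocalization.injective R hS)).1 this) }
  have hval : ValuationRing R := inferInstance
  let V : ValuationSubring K := ValuationSubring.ofSubring R.toSubring fun x => by
    rcases ValuationRing.isInteger_or_isInteger R x with ⟨y, hy⟩ | ⟨y, hy⟩
    · exact Or.inl (hy ▸ y.2)
    · exact Or.inr (hy ▸ y.2)
  refine ⟨V, hdvr, fun x => ?_⟩
  constructor
  · rintro ⟨a, s, hs, rfl⟩
    exact ⟨a, s, hs, rfl⟩
  · rintro ⟨a, s, hs, rfl⟩
    exact ⟨a, s, hs, rfl⟩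

/-- For finite sets F of such primes, the divisorial ideals x(⋂F)⁻¹ grow with F, so ACC supplies an
F where this ideal is maximal. Adjoining a further P then leaves ⋂F unchanged, so P contains, hence
equals, a member of F. -/
theorem finite_maximalDivisorial_mem [WellFoundedGT {A : Ideal D // IsDivisorial K A}] {x : D}
    (hx : x ≠ 0) : {P | IsMaximalDivisorial K P ∧ x ∈ P}.Finite := by
  set X : FractionalIdeal D⁰ K := FractionalIdeal.spanSingleton D⁰ (algebraMap D K x) with hX
  have hx' : algebraMap D K x ≠ 0 := by simpa using hx
  have hX0 : X ≠ 0 := FractionalIdeal.spanSingleton_ne_zero_iff.2 hx'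
  have hXi : X⁻¹ * X = 1 := FractionalIdeal.spanSingleton_inv_mul K hx'
  let good : Finset (Ideal D) → Prop := fun F => ∀ P ∈ F, IsMaximalDivisorial K P ∧ x ∈ P
  have hmem : ∀ F, good F → x ∈ F.inf id := fun F hF => by
    rw [Submodule.mem_finsetInf]
    exact fun P hP => (hF P hP).2
  have hne : ∀ F, good F → F.inf id ≠ ⊥ := fun F hF h0 => hx (by simpa [h0] using hmem F hF)
  have hdiv : ∀ F, good F → IsDivisorial K (F.inf id) := by
    intro F hF
    refine IsDivisorial.of_vClosure_le (hne F hF) fun B hB => Finset.le_inf fun P hP => ?_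
    rw [id, ← FractionalIdeal.coeIdeal_le_coeIdeal K, hB, ← (hF P hP).1.1.1.2]
    exact vClosure_mono ((FractionalIdeal.coeIdeal_le_coeIdeal K).2 (Finset.inf_le hP))
  have hex : ∀ F, good F → ∃ Q : Ideal D, IsDivisorial K Q ∧
      (Q : FractionalIdeal D⁰ K) = X * ((F.inf id : Ideal D) : FractionalIdeal D⁰ K)⁻¹ := by
    intro F hF
    have h0 : ((F.inf id : Ideal D) : FractionalIdeal D⁰ K) ≠ 0 :=
      FractionalIdeal.coeIdeal_ne_zero.2 (hne F hF)
    have hXF : X ≤ (F.inf id : Ideal D) := FractionalIdeal.spanSingleton_le_iff_mem.2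
      (FractionalIdeal.mem_coeIdeal_of_mem _ (hmem F hF))
    obtain ⟨Q, hQ⟩ := FractionalIdeal.le_one_iff_exists_coeIdeal.1
      ((mul_le_mul_left hXF ((F.inf id : Ideal D) : FractionalIdeal D⁰ K)⁻¹).trans
        (mul_inv_le_one _))
    refine ⟨Q, ⟨?_, ?_⟩, hQ⟩
    · rw [← FractionalIdeal.coeIdeal_ne_zero (K := K), hQ]
      exact mul_ne_zero_of_ne_zero hX0 (inv_ne_zero_of_ne_zero h0)
    · refine le_antisymm ?_ (le_vClosure _)
      have := mul_vClosure_le X⁻¹ (X * ((F.inf id : Ideal D) : FractionalIdeal D⁰ K)⁻¹)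
      rw [← mul_assoc X⁻¹ X, hXi, one_mul, vClosure_inv h0] at this
      rw [hQ]
      calc _ = X * (X⁻¹ * vClosure (X * ((F.inf id : Ideal D) : FractionalIdeal D⁰ K)⁻¹)) := by
            rw [← mul_assoc, mul_comm X X⁻¹, hXi, one_mul]
        _ ≤ _ := mul_le_mul_right this _
  -- The empty intersection is D, so Q₀ = xD starts the family.
  obtain ⟨Q₀, hQ₀, hQ₀'⟩ := hex ∅ (by simp [good])
  obtain ⟨Q, -, ⟨hQ, F, hF, hQF⟩, hmax⟩ := exists_maximal_divisorial (K := K)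
    (p := fun Q => IsDivisorial K Q ∧ ∃ F, good F ∧
      (Q : FractionalIdeal D⁰ K) = X * ((F.inf id : Ideal D) : FractionalIdeal D⁰ K)⁻¹)
    (fun _ h => h.1) (A := Q₀) ⟨hQ₀, ∅, by simp [good], hQ₀'⟩
  classical
  refine F.finite_toSet.subset ?_
  rintro P ⟨hP, hxP⟩
  have hF' : good (insert P F) := by
    intro P' hP'
    rcases Finset.mem_insert.1 hP' with rfl | h
    · exact ⟨hP, hxP⟩
    · exact hF P' h
  have hle : (insert P F).inf id ≤ F.inf id := Finset.inf_mono (Finset.subset_insert P F)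
  have hle' := (FractionalIdeal.coeIdeal_le_coeIdeal K).2 hle
  have h0 : ((F.inf id : Ideal D) : FractionalIdeal D⁰ K) ≠ 0 :=
    FractionalIdeal.coeIdeal_ne_zero.2 (hne F hF)
  have h0' : (((insert P F).inf id : Ideal D) : FractionalIdeal D⁰ K) ≠ 0 :=
    FractionalIdeal.coeIdeal_ne_zero.2 (hne _ hF')
  obtain ⟨Q', hQ', hQF'⟩ := hex _ hF'
  have hQQ' : Q ≤ Q' := by
    rw [← FractionalIdeal.coeIdeal_le_coeIdeal K, hQF, hQF']
    exact mul_le_mul_right (FractionalIdeal.inv_anti_mono h0' h0 hle') X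
  have hQ'Q := hmax ⟨hQ', _, hF', hQF'⟩ hQQ'
  rw [← FractionalIdeal.coeIdeal_le_coeIdeal K, hQF, hQF'] at hQ'Q
  have hcancel := mul_le_mul_right hQ'Q X⁻¹
  rw [← mul_assoc, ← mul_assoc, hXi, one_mul, one_mul] at hcancel
  have hinv := FractionalIdeal.inv_anti_mono (inv_ne_zero_of_ne_zero h0')
    (inv_ne_zero_of_ne_zero h0) hcancel
  change vClosure _ ≤ vClosure _ at hinv
  rw [(hdiv _ hF).2, (hdiv _ hF').2, FractionalIdeal.coeIdeal_le_coeIdeal] at hinv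
  have hFP : F.inf id ≤ P := hinv.trans (Finset.inf_le (Finset.mem_insert_self P F))
  obtain ⟨P', hP', hPP'⟩ := (Ideal.IsPrime.inf_le' hP.isPrime).1 hFP
  have : P' = P := le_antisymm hPP' ((hF P' hP').1.2 hP.1 hPP')
  exact this ▸ hP'

theorem AllVInvertible.isKrull (hv : AllVInvertible D K)
    (ht : ∀ I : FractionalIdeal D⁰ K, I ≠ 0 → tClosure I = vClosure I) : IsKrull D K := by
  have := hv.wellFoundedGT ht
  have hW : ∀ P : {P : Ideal D // IsMaximalDivisorial K P}, ∃ V : ValuationSubring K,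
      IsDiscreteValuationRing V ∧
        ∀ x, x ∈ V ↔ ∃ a, ∃ s ∉ P.1, x = algebraMap D K a * (algebraMap D K s)⁻¹ := fun P =>
    haveI := P.2.isPrime
    exists_valuationSubring_of_local_generator P.2.1.1.1
      fun _ hA => hv.exists_local_generator P.2 hA
  choose W hW1 hW2 using hW
  refine ⟨Set.range W, ?_, fun x => ⟨?_, fun hx => ?_⟩, fun x hx => ?_⟩
  · rintro _ ⟨P, rfl⟩
    exact hW1 P
  · rintro ⟨d, rfl⟩ _ ⟨P, rfl⟩
    exact (hW2 P _).2 ⟨d, 1, fun h => P.2.1.2 ((Ideal.eq_top_iff_one _).2 h), by simp⟩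
  -- For L = D + xD, the inverse L⁻¹ is the ideal of denominators of x. It is divisorial; if proper,
  -- it would lie in some P, although x ∈ D_P has a denominator outside P.
  · set L : FractionalIdeal D⁰ K := 1 ⊔ FractionalIdeal.spanSingleton D⁰ x with hL
    have h10 : (1 : FractionalIdeal D⁰ K) ≠ 0 := by
      rw [← FractionalIdeal.coeIdeal_top, FractionalIdeal.coeIdeal_ne_zero]
      exact top_ne_bot
    have hL0 : L ≠ 0 := ne_zero_of_ne_zero_le h10 le_sup_left
    have hLi : L⁻¹ ≤ 1 := by
      simpa using FractionalIdeal.inv_anti_mono h10 hL0 (le_sup_left : 1 ≤ L)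
    obtain ⟨A, hA⟩ := FractionalIdeal.le_one_iff_exists_coeIdeal.1 hLi
    have hAdiv : IsDivisorial K A := by
      refine ⟨?_, by rw [hA, vClosure_inv hL0]⟩
      rw [← FractionalIdeal.coeIdeal_ne_zero (K := K), hA]
      exact inv_ne_zero_of_ne_zero hL0
    have hAmem : ∀ d a : D, algebraMap D K d * x = algebraMap D K a → d ∈ A := by
      intro d a hda
      suffices algebraMap D K d ∈ (A : FractionalIdeal D⁰ K) by
        obtain ⟨d', hd', hdd'⟩ := (FractionalIdeal.mem_coeIdeal _).1 this
        exact IsFractionRing.injective D K hdd' ▸ hd'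
      rw [hA, ← FractionalIdeal.spanSingleton_le_iff_mem, le_inv_iff_mul_le_one hL0, hL,
        FractionalIdeal.sup_eq_add, mul_add, ← FractionalIdeal.sup_eq_add]
      refine sup_le ?_ ?_
      · rw [mul_one, FractionalIdeal.spanSingleton_le_iff_mem]
        exact FractionalIdeal.coe_mem_one _ _
      · rw [FractionalIdeal.spanSingleton_mul_spanSingleton, hda,
          FractionalIdeal.spanSingleton_le_iff_mem]
        exact FractionalIdeal.coe_mem_one _ _
    have hAtop : A = ⊤ := by
      by_contra hne
      obtain ⟨P, hAP, hP⟩ := exists_maximal_divisorial (K := K)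
        (p := fun A => IsDivisorial K A ∧ A ≠ ⊤) (fun _ h => h.1) ⟨hAdiv, hne⟩
      obtain ⟨a, s, hs, hxs⟩ := (hW2 ⟨P, hP⟩ x).1 (hx _ ⟨_, rfl⟩)
      have hs0 : algebraMap D K s ≠ 0 := by
        rw [Ne, map_eq_zero_iff _ (IsFractionRing.injective D K)]
        rintro rfl
        exact hs (zero_mem _)
      exact hs (hAP (hAmem s a (by rw [hxs]; field_simp)))
    rw [hAtop, FractionalIdeal.coeIdeal_top] at hA
    have hL1 := (le_inv_iff_mul_le_one hL0).1 hA.le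
    rw [one_mul] at hL1
    have := FractionalIdeal.spanSingleton_le_iff_mem.1 ((le_sup_right.trans hL1 : _ ≤ _))
    exact (FractionalIdeal.mem_one_iff _).1 this
  · obtain ⟨a, b, hb, rfl⟩ := IsFractionRing.div_surjective (A := D) x
    have ha0 : a ≠ 0 := by
      rintro rfl
      simp at hx
    have hb0 : b ≠ 0 := nonZeroDivisors.ne_zero hb
    have hfin := ((finite_maximalDivisorial_mem (K := K) ha0).union
      (finite_maximalDivisorial_mem (K := K) hb0)).preimage
        (Subtype.val_injective (p := IsMaximalDivisorial K)).injOn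
    refine (hfin.image W).subset ?_
    rintro _ ⟨⟨P, rfl⟩, hV⟩
    -- If neither a nor b lies in P, then a/b and b/a are both in D_P, so a/b is a unit there.
    refine ⟨P, ?_, rfl⟩
    by_contra hcon
    have haP : a ∉ P.1 := fun h => hcon (Or.inl ⟨P.2, h⟩)
    have hbP : b ∉ P.1 := fun h => hcon (Or.inr ⟨P.2, h⟩)
    refine hV (le_antisymm ?_ ?_)
    · rw [ValuationSubring.valuation_le_one_iff]
      exact (hW2 P _).2 ⟨a, b, hbP, div_eq_mul_inv _ _⟩
    · rw [← inv_le_one₀ (zero_lt_iff.2 ((map_ne_zero _).2 hx)), ← map_inv₀,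
        ValuationSubring.valuation_le_one_iff]
      exact (hW2 P _).2 ⟨b, a, haP, by rw [inv_div, div_eq_mul_inv]⟩

end Divisorial

/-! ### Two facts about discrete valuation rings -/

section DVR

variable {K : Type*} [Field K] (V : ValuationSubring K) [IsDiscreteValuationRing V]

/-- A DVR is completely integrally closed: if y ∉ V, then y⁻¹ is a nonunit all of whose powers
divide c ≠ 0. -/
theorem mem_of_forall_pow_mul_mem {y c : K} (hc : c ≠ 0) (h : ∀ n : ℕ, y ^ n * c ∈ V) : y ∈ V := by
  by_contra hy
  have hy0 : y ≠ 0 := fun h0 => hy (h0 ▸ V.zero_mem)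
  have hyi : y⁻¹ ∈ V := (V.mem_or_inv_mem y).resolve_left hy
  have hunit : ¬ IsUnit (⟨y⁻¹, hyi⟩ : V) := by
    intro hu
    obtain ⟨⟨z, hz⟩, hz'⟩ := hu.exists_right_inv
    have h1 : y⁻¹ * z = 1 := congrArg Subtype.val hz'
    rw [inv_mul_eq_one₀ hy0] at h1
    exact hy (h1 ▸ hz)
  have hcV : c ∈ V := by simpa using h 0
  obtain ⟨n, hn⟩ := FiniteMultiplicity.of_not_isUnit hunit
    (b := (⟨c, hcV⟩ : V)) (fun h0 => hc (congrArg Subtype.val h0))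
  refine hn ⟨⟨_, h (n + 1)⟩, Subtype.ext ?_⟩
  change c = (y⁻¹) ^ (n + 1) * (y ^ (n + 1) * c)
  rw [← mul_assoc, ← mul_pow, inv_mul_cancel₀ hy0, one_pow, one_mul]

/-- The factor a moves s into V, where an element of least valuation divides all the others. -/
theorem exists_forall_mul_inv_mem {s : Set K} {a : K} (ha : a ≠ 0) (hs : ∀ x ∈ s, a * x ∈ V)
    (hne : ∃ x ∈ s, x ≠ 0) : ∃ d ∈ s, d ≠ 0 ∧ ∀ x ∈ s, x * d⁻¹ ∈ V := by
  obtain ⟨c, hc, hc0⟩ := hne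
  obtain ⟨m, ⟨hm0, d, hd, hmd⟩, hmin⟩ :=
    (InvImage.wf (IsDiscreteValuationRing.addVal V) wellFounded_lt).has_min
      {v : V | v ≠ 0 ∧ ∃ x ∈ s, (v : K) = a * x}
      ⟨⟨a * c, hs c hc⟩, fun h => mul_ne_zero ha hc0 (congrArg Subtype.val h), c, hc, rfl⟩
  have hd0 : d ≠ 0 := by
    rintro rfl
    exact hm0 (Subtype.ext (by rw [hmd, mul_zero]; rfl))
  refine ⟨d, hd, hd0, fun x hx => ?_⟩
  by_cases hx0 : x = 0
  · rw [hx0, zero_mul]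
    exact V.zero_mem
  have hle := not_lt.1 (hmin ⟨a * x, hs x hx⟩
    ⟨fun h => mul_ne_zero ha hx0 (congrArg Subtype.val h), x, hx, rfl⟩)
  obtain ⟨⟨w, hw⟩, hmw⟩ := IsDiscreteValuationRing.addVal_le_iff_dvd.1 hle
  have h1 : a * x = m * w := congrArg Subtype.val hmw
  have h2 : x * d⁻¹ = w := by
    rw [hmd, mul_assoc] at h1
    rw [mul_left_cancel₀ ha h1]
    field_simp
  exact h2 ▸ hw

end DVR

/-! ### Consequences of the Krull property -/

section Krull

variable {D : Type*} [CommRing D] [IsDomain D] {K : Type*} [Field K] [Algebra D K]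
  [IsFractionRing D K]

/-- If y A A⁻¹ ⊆ D, then y A⁻¹ ⊆ A⁻¹, so all yⁿ lie in A⁻¹ and yⁿc ∈ D for a fixed 0 ≠ c ∈ A.
Complete integral closedness of each V gives y ∈ D. -/
theorem IsKrull.allVInvertible (h : IsKrull D K) : AllVInvertible D K := by
  obtain ⟨S, hS, hD, -⟩ := h
  intro A hA
  have hA' : (A : FractionalIdeal D⁰ K) ≠ 0 := FractionalIdeal.coeIdeal_ne_zero.2 hA
  have hM := mul_ne_zero_of_ne_zero hA' (inv_ne_zero_of_ne_zero hA')
  refine le_antisymm (vClosure_le_one (mul_inv_le_one _)) ?_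
  rw [vClosure, le_inv_iff_mul_le_one (inv_ne_zero_of_ne_zero hM), one_mul]
  intro y hy
  rw [FractionalIdeal.mem_inv_iff hM] at hy
  have hpow : ∀ n : ℕ, y ^ n ∈ (A : FractionalIdeal D⁰ K)⁻¹ := by
    intro n
    induction n with
    | zero =>
      rw [FractionalIdeal.mem_inv_iff hA']
      intro a ha
      simpa using FractionalIdeal.coeIdeal_le_one ha
    | succ n ih =>
      rw [FractionalIdeal.mem_inv_iff hA']
      intro a ha
      rw [pow_succ', mul_assoc, mul_comm _ a]
      exact hy _ (FractionalIdeal.mul_mem_mul ha ih)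
  obtain ⟨c, hcA, hc⟩ := Submodule.exists_mem_ne_zero_of_ne_bot hA
  refine (FractionalIdeal.mem_one_iff _).2 ((hD y).2 fun V hV => ?_)
  have := hS V hV
  refine mem_of_forall_pow_mul_mem V (c := algebraMap D K c) (by simpa using hc) fun n => ?_
  refine (hD _).1 ?_ V hV
  exact (FractionalIdeal.mem_one_iff _).1 ((FractionalIdeal.mem_inv_iff hA').1 (hpow n) _
    (FractionalIdeal.mem_coeIdeal_of_mem _ hcA))

/-- Fix 0 ≠ c' ∈ I and a ≠ 0 with aI ⊆ D. Off a finite set T both are units in V, so c' alone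
controls I there; for each V ∈ T one more generator, of least value in I, suffices. -/
theorem IsKrull.stronglyVFinite (h : IsKrull D K) : StronglyVFinite D K := by
  obtain ⟨S, hS, hD, hfin⟩ := h
  intro I hI
  obtain ⟨c, hc, hcI⟩ := FractionalIdeal.exists_ne_zero_mem_isInteger hI
  set c' := algebraMap D K c
  have hc' : c' ≠ 0 := by simpa [c'] using hc
  set a := algebraMap D K (I.den : D)
  have ha : a ≠ 0 := by simp [a]
  have haI : ∀ x ∈ I, ∀ V ∈ S, a * x ∈ V := fun x hx =>
    (hD _).1 ((FractionalIdeal.mem_one_iff _).1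
      ((FractionalIdeal.mem_inv_iff hI).1 (FractionalIdeal.den_mem_inv hI) x hx))
  have hd : ∀ V : ValuationSubring K, ∃ d ∈ I, V ∈ S → d ≠ 0 ∧ ∀ x ∈ I, x * d⁻¹ ∈ V := by
    intro V
    by_cases hV : V ∈ S
    · have := hS V hV
      obtain ⟨d, h1, h2⟩ := exists_forall_mul_inv_mem V (s := {x | x ∈ I}) ha
        (fun x hx => haI x hx V hV) ⟨c', hcI, hc'⟩
      exact ⟨d, h1, fun _ => h2⟩
    · exact ⟨c', hcI, fun h => absurd h hV⟩
  choose d hdI hd using hd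
  have hT := (hfin a ha).union (hfin c' hc')
  set T := {V ∈ S | V.valuation a ≠ 1} ∪ {V ∈ S | V.valuation c' ≠ 1}
  have hGfg : (Submodule.span D (insert c' (d '' T))).FG :=
    Submodule.fg_span ((hT.image d).insert c')
  set G : FractionalIdeal D⁰ K := ⟨_, FractionalIdeal.isFractional_of_fg hGfg⟩
  have hmemG : ∀ x ∈ insert c' (d '' T), x ∈ G := fun x hx => Submodule.subset_span hx
  have hGI : G ≤ I := by
    refine (Submodule.span_le (p := (I : Submodule D K))).2 (Set.insert_subset hcI ?_)
    rintro _ ⟨V, -, rfl⟩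
    exact hdI V
  have hG0 : G ≠ 0 := by
    intro h0
    have := hmemG c' (Set.mem_insert _ _)
    rw [h0, FractionalIdeal.mem_zero_iff] at this
    exact hc' this
  refine ⟨G, hGI, hGfg, ?_⟩
  rw [vClosure, le_inv_iff_mul_le_one (inv_ne_zero_of_ne_zero hG0), FractionalIdeal.mul_le]
  intro x hx y hy
  rw [FractionalIdeal.mem_inv_iff hG0] at hy
  have hyV : ∀ g ∈ insert c' (d '' T), ∀ V ∈ S, y * g ∈ V := fun g hg =>
    (hD _).1 ((FractionalIdeal.mem_one_iff _).1 (hy g (hmemG g hg)))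
  refine (FractionalIdeal.mem_one_iff _).2 ((hD _).2 fun V hV => ?_)
  by_cases hVT : V ∈ T
  · obtain ⟨hd0, hdV⟩ := hd V hV
    have := V.mul_mem _ _ (hdV x hx) (hyV (d V) (Set.mem_insert_of_mem _ ⟨V, hVT, rfl⟩) V hV)
    rwa [show x * (d V)⁻¹ * (y * d V) = x * y by field_simp] at this
  · have hVa : V.valuation a = 1 := by
      by_contra hne
      exact hVT (Or.inl ⟨hV, hne⟩)
    have hVc : V.valuation c' = 1 := by
      by_contra hne
      exact hVT (Or.inr ⟨hV, hne⟩)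
    have h1 := (V.valuation_le_one_iff _).2 (haI x hx V hV)
    have h2 := (V.valuation_le_one_iff _).2 (hyV c' (Set.mem_insert _ _) V hV)
    rw [map_mul, hVa, one_mul] at h1
    rw [map_mul, hVc, mul_one] at h2
    rw [← V.valuation_le_one_iff, map_mul]
    exact mul_le_one' h1 h2

end Krull

end StarIdeal

theorem mainTheorem9 (D : Type*) [CommRing D] [IsDomain D] (K : Type*) [Field K] [Algebra D K]
    [IsFractionRing D K] :
    StarIdeal.IsKrull D K ↔ StarIdeal.IsTSharp D K ∧ StarIdeal.IsTV D K := by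
  constructor
  · intro h
    have ht : ∀ I : FractionalIdeal D⁰ K, I ≠ 0 →
        StarIdeal.tClosure I = StarIdeal.vClosure I := fun _ hI => h.stronglyVFinite.tClosure_eq hI
    exact ⟨h.allVInvertible.isTSharp ht, StarIdeal.isTV_iff.2 ht⟩
  · rintro ⟨hs, ht⟩
    rw [StarIdeal.isTV_iff] at ht
    exact (StarIdeal.AllVInvertible.of_isTSharp hs ht).isKrull ht
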